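/- A finite $2$-$(v,k,\lambda)$ design has $v$ points and finitely many blocks, each block being a $k$-subset of the point set, such that any two distinct points lie together in exactly $\lambda$ blocks. It is quasi-symmetric if the numbers $|A\cap B|$, for distinct blocks $A,B$, take exactly two values $\lambda_1<\lambda_2$; its defect is $\lambda_2-\lambda_1$, and its block graph has the blocks as vertices, two distinct blocks being adjacent if and only if they have exactly $\lambda_2$ points in common. For integers $m>n\ge 2$ such that $n$ divides $m(m-1)$, a Steiner graph $S_n(m)$ is any graph isomorphic to the block graph of a $2$-$(mn-m+1,\,n,\,1)$ design (for such a design $\lambda_1=0$, $\lambda_2=1$, and every point lies in $m$ blocks). **Corollary 4.7.** Let $m>n\ge 2$ be integers such that $n$ divides $m(m-1)$, and let $\mu$ be a positive integer. Suppose that there is a quasi-symmetric $2$-design of defect $\mu$ whose block graph is a Steiner graph $S_n(m)$. Then: (a) if $m$ is odd and $n$ is even, then $\mu$ is a perfect square; (b) the equation $$\mu x^2+(-1)^{\binom{mn-m}{2}}(mn-m+1)\,y^2=z^2$$ has a solution $(x,y,z)\neq(0,0,0)$ in integers. -/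

import Mathlib

/-- A finite incidence system: `P` is the set of points and the blocks are subsets of `P`,
indexed by `B`. Indexing allows the same subset to occur as several blocks
(a collection of blocks without repetition is the case where `block` is injective). -/
structure IncidenceSystem (P : Type*) (B : Type*) where
  /-- The set of points of a block. -/
  block : B → Finset P

namespace IncidenceSystem

/-- `D` is a `2-(v, k, l)` design: there are `v` points, every block has `k` points, and any two
distinct points are together in exactly `l` blocks. -/
structure IsTwoDesign {P B : Type*} [Fintype P] [DecidableEq P] [Fintype B]
    (D : IncidenceSystem P B) (v k l : ℕ) : Prop where
  card_points : Fintype.card P = v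
  card_block : ∀ i : B, (D.block i).card = k
  balance : ∀ x y : P, x ≠ y →
    (Finset.univ.filter (fun i : B => x ∈ D.block i ∧ y ∈ D.block i)).card = l

/-- The numbers `x` such that some two distinct blocks have exactly `x` common points. -/
def intersectionNumbers {P B : Type*} [DecidableEq P] (D : IncidenceSystem P B) : Set ℕ :=
  {x | ∃ i j : B, i ≠ j ∧ (D.block i ∩ D.block j).card = x}

/-- `D` has exactly two intersection numbers, the smaller being `l₁` and the larger `l₂`. -/
def IsQuasiSymmetric {P B : Type*} [DecidableEq P] (D : IncidenceSystem P B) (l₁ l₂ : ℕ) : Prop :=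
  l₁ < l₂ ∧ D.intersectionNumbers = {l₁, l₂}

/-- The graph on the blocks of `D` in which two distinct blocks are adjacent exactly when they have
`l₂` common points. If `D.IsQuasiSymmetric l₁ l₂`, this is the block graph of `D`. -/
def blockGraph {P B : Type*} [DecidableEq P] (D : IncidenceSystem P B) (l₂ : ℕ) :
    SimpleGraph B where
  Adj i j := i ≠ j ∧ (D.block i ∩ D.block j).card = l₂
  symm := ⟨fun i j h => ⟨h.1.symm, by rw [Finset.inter_comm]; exact h.2⟩⟩
  loopless := ⟨fun _ h => h.1 rfl⟩

end IncidenceSystem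

/-- `G` is a Steiner graph `S_n(m)`: it is isomorphic to the block graph of some Steiner 2-design
with parameters `2-(mn - m + 1, n, 1)` (each point is then in `m` blocks). For `m > n ≥ 2` the
intersection numbers of such a design are `0` and `1`, so blocks are adjacent when they meet in
one point. Up to isomorphism the points and the blocks may be taken to be numbered. -/
def IsSteinerGraph (n m : ℕ) {V : Type*} (G : SimpleGraph V) : Prop :=
  ∃ (b : ℕ) (S : IncidenceSystem (Fin (m * n - m + 1)) (Fin b)),
    S.IsTwoDesign (m * n - m + 1) n 1 ∧ Nonempty (G ≃g S.blockGraph 1)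

/-! Let `N` and `M` be the incidence matrices of the quasi-symmetric design and of the Steiner
design, with blocks matched along the graph isomorphism, and let `J` be all-ones. Equality of the
block graphs gives `NᵀN = μMᵀM + cI + l₁J`. Each Gram matrix satisfies a quadratic equation modulo
`J`; comparing the two forces `c = 0` (`gram_coefficients`), and a trace count then shows that both
designs have `v = mn - m + 1` points. Hence `NMᵀ/(m-1)`, corrected by a multiple of `J`, is a square
rational matrix `R` with `RᵀR = μI + vw²J`, where `w = (μ-1)/(2v)` (`exists_similarity_matrix`).

The rest is Bruck–Ryser. For even `v`, determinants make `μ` a square. For odd `v`, read `RᵀR` as an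
identity of quadratic forms: by Lagrange, `μ` times a sum of four squares is again the sum of the
squares of four linear forms, and cancelling squares in pairs (`exists_cancel_squares`) leaves the
ternary equation. -/

open Matrix

/-! ### Elimination of squares and four-square similarities -/

/-- If linear forms `f i` together with `h` separate points, signs can be chosen so that the forms
`f i - ε i • g i` together with `h` still separate points. -/
theorem exists_signs_separating {W ι : Type*} [AddCommGroup W] [Module ℚ W] [Fintype ι]
    [DecidableEq ι] (f g : ι → W →ₗ[ℚ] ℚ) (h : W →ₗ[ℚ] ℚ)
    (hinj : ∀ x, (∀ i, f i x = 0) → h x = 0 → x = 0) (s : Finset ι) :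
    ∃ ε : ι → ℚ, (∀ i, ε i ^ 2 = 1) ∧ ∀ x, (∀ i ∈ s, f i x = ε i * g i x) →
      (∀ i, i ∉ s → f i x = 0) → h x = 0 → x = 0 := by
  induction s using Finset.induction_on with
  | empty => exact ⟨fun _ => 1, by simp, fun x _ h1 h2 => hinj x (fun i => h1 i (by simp)) h2⟩
  | insert a s ha ih =>
    obtain ⟨ε, hε, H⟩ := ih
    have key : ∃ δ : ℚ, δ ^ 2 = 1 ∧ ∀ x, (∀ i ∈ s, f i x = ε i * g i x) → f a x = δ * g a x →
        (∀ i, i ∉ insert a s → f i x = 0) → h x = 0 → x = 0 := by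
      by_contra! hc
      obtain ⟨e, he1, he2, he3, he4, he0⟩ := hc 1 (by norm_num)
      obtain ⟨e', he1', he2', he3', he4', he0'⟩ := hc (-1) (by norm_num)
      have nz : ∀ x, (∀ i ∈ s, f i x = ε i * g i x) →
          (∀ i, i ∉ insert a s → f i x = 0) → h x = 0 → f a x = 0 → x = 0 := by
        intro x h1 h2 h3 h4
        refine H x h1 (fun i hi => ?_) h3
        by_cases hia : i = a
        · rw [hia, h4]
        · exact h2 i (by simp [hia, hi])
      have n1 : f a e ≠ 0 := fun h0 => he0 (nz e he1 he3 he4 h0)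
      have n2 : f a e' ≠ 0 := fun h0 => he0' (nz e' he1' he3' he4' h0)
      -- If both signs fail, with witnesses `e` and `e'`, this combination lies in the kernel of `f
      -- a`, so it vanishes. Applying `g a`, which is `f a` on `e` and `-f a` on `e'`, gives `2 * f
      -- a e * f a e' = 0`.
      have hz : f a e' • e - f a e • e' = 0 := by
        apply nz
        · intro i hi
          simp only [map_sub, map_smul, smul_eq_mul, he1 i hi, he1' i hi]
          ring
        · intro i hi
          simp [he3 i hi, he3' i hi]
        · simp [he4, he4']
        · simp only [map_sub, map_smul, smul_eq_mul]
          ring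
      have := congrArg (g a) hz
      simp only [map_sub, map_smul, smul_eq_mul, map_zero] at this
      have h5 : f a e * f a e' = 0 := by
        rw [show g a e = f a e by linarith, show g a e' = - f a e' by linarith] at this
        linarith
      rcases mul_eq_zero.mp h5 with h | h <;> contradiction
    obtain ⟨δ, hδ, hk⟩ := key
    refine ⟨Function.update ε a δ, fun i => ?_, fun x h1 h2 h3 => ?_⟩
    · by_cases hia : i = a
      · subst hia; simpa using hδ
      · simpa [hia] using hε i
    · refine hk x (fun i hi => ?_) ?_ h2 h3
      · have hia : i ≠ a := fun h => ha (h ▸ hi)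
        simpa [hia] using h1 i (by simp [hi])
      · simpa using h1 a (by simp)

/-- Bruck–Ryser elimination: squares of fewer pairs of forms than the dimension can be
cancelled simultaneously without killing `h`. -/
theorem exists_cancel_squares {W ι : Type*} [AddCommGroup W] [Module ℚ W] [Module.Finite ℚ W]
    [Fintype ι] (f g : ι → W →ₗ[ℚ] ℚ) (h : W →ₗ[ℚ] ℚ)
    (hinj : ∀ x, (∀ i, f i x = 0) → h x = 0 → x = 0)
    (hcard : Fintype.card ι < Module.finrank ℚ W) :
    ∃ x, h x ≠ 0 ∧ ∀ i, f i x ^ 2 = g i x ^ 2 := by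
  classical
  obtain ⟨ε, hε, H⟩ := exists_signs_separating f g h hinj Finset.univ
  let F : W →ₗ[ℚ] (ι → ℚ) := LinearMap.pi fun i => f i - ε i • g i
  have hF : LinearMap.ker F ≠ ⊥ := LinearMap.ker_ne_bot_of_finrank_lt (by simpa using hcard)
  obtain ⟨x, hx, hx0⟩ := (Submodule.ne_bot_iff _).mp hF
  have hfx : ∀ i, f i x = ε i * g i x := by
    intro i
    have := congrFun (LinearMap.mem_ker.mp hx) i
    simp only [F, LinearMap.pi_apply, LinearMap.sub_apply, LinearMap.smul_apply, smul_eq_mul,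
      Pi.zero_apply] at this
    linarith
  refine ⟨x, fun h0 => hx0 (H x (fun i _ => hfx i) (by simp) h0), fun i => ?_⟩
  rw [hfx i, mul_pow, hε, one_mul]

/-- Four-dimensional similarities with any natural multiplier, from Lagrange's theorem. -/
theorem exists_similarity_of_four_dvd (μ N : ℕ) (hN : 4 ∣ N) :
    ∃ c : (Fin N → ℚ) →ₗ[ℚ] (Fin N → ℚ), ∀ y, ∑ i, c y i ^ 2 = μ * ∑ i, y i ^ 2 := by
  obtain ⟨t, rfl⟩ := hN
  obtain ⟨p, q, r, s, hμ⟩ := Nat.sum_four_squares μ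
  have hμ' : (μ : ℚ) = p ^ 2 + q ^ 2 + r ^ 2 + s ^ 2 := by rw [← hμ]; push_cast; ring
  let e : Fin 4 × Fin t ≃ Fin (4 * t) := finProdFinEquiv
  -- A quaternion multiplication matrix: its columns are orthogonal of squared length `μ`. The map
  -- `c` applies it to each of the `t` groups of four coordinates.
  let H : Matrix (Fin 4) (Fin 4) ℚ :=
    !![p, q, r, s; -q, p, -s, r; -r, s, p, -q; -s, -r, q, p]
  let c : (Fin (4 * t) → ℚ) →ₗ[ℚ] (Fin (4 * t) → ℚ) :=
    { toFun := fun y i => ∑ j, H (e.symm i).1 j * y (e (j, (e.symm i).2))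
      map_add' := by
        intro x y; ext i
        simp only [Pi.add_apply, mul_add, Finset.sum_add_distrib]
      map_smul' := by
        intro a y; ext i
        simp only [Pi.smul_apply, smul_eq_mul, RingHom.id_apply, Finset.mul_sum]
        exact Finset.sum_congr rfl fun _ _ => by ring }
  refine ⟨c, fun y => ?_⟩
  rw [← e.sum_comp, ← e.sum_comp, Fintype.sum_prod_type_right, Fintype.sum_prod_type_right,
    Finset.mul_sum]
  refine Finset.sum_congr rfl fun l _ => ?_
  simp only [c, LinearMap.coe_mk, AddHom.coe_mk, Equiv.symm_apply_apply, Fin.sum_univ_four, H]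
  simp [hμ']
  ring

/-- A rational zero of a diagonal ternary form can be scaled to an integral one. -/
theorem exists_int_ternary_zero {a c : ℤ} {x y z : ℚ} (h0 : x ≠ 0 ∨ z ≠ 0)
    (h : a * x ^ 2 + c * y ^ 2 = z ^ 2) :
    ∃ x y z : ℤ, (x, y, z) ≠ (0, 0, 0) ∧ a * x ^ 2 + c * y ^ 2 = z ^ 2 := by
  refine ⟨x.num * y.den * z.den, y.num * x.den * z.den, z.num * x.den * y.den, ?_, ?_⟩
  · have hx := x.den_ne_zero
    have hy := y.den_ne_zero
    have hz := z.den_ne_zero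
    simp only [ne_eq, Prod.mk.injEq, mul_eq_zero, Rat.num_eq_zero, Nat.cast_eq_zero, hx, hy, hz]
    tauto
  · have hx : (x.num : ℚ) = x * x.den := (Rat.mul_den_eq_num x).symm
    have hy : (y.num : ℚ) = y * y.den := (Rat.mul_den_eq_num y).symm
    have hz : (z.num : ℚ) = z * z.den := (Rat.mul_den_eq_num z).symm
    have : ((a * (x.num * y.den * z.den) ^ 2 + c * (y.num * x.den * z.den) ^ 2 : ℤ) : ℚ)
        = ((z.num * x.den * y.den) ^ 2 : ℤ) := by
      push_cast
      rw [hx, hy, hz]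
      linear_combination (x.den * y.den * z.den : ℚ) ^ 2 * h
    exact_mod_cast this

/-! ### Bruck–Ryser arguments for `RᵀR = μI + γJ` -/

/-- The rational all-ones matrix. -/
abbrev allOnes (X Y : Type*) : Matrix X Y ℚ := Matrix.of fun _ _ => 1

theorem sum_mulVec_sq {P : Type*} [Fintype P] {v : ℕ} {μ γ : ℚ} {R : Matrix P (Fin v) ℚ}
    (hR : Rᵀ * R = μ • (1 : Matrix (Fin v) (Fin v) ℚ) + γ • allOnes _ _)
    (y : Fin v → ℚ) :
    ∑ i, (R *ᵥ y) i ^ 2 = μ * ∑ i, y i ^ 2 + γ * (∑ i, y i) ^ 2 := by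
  have h1 : ∑ i, (R *ᵥ y) i ^ 2 = (R *ᵥ y) ⬝ᵥ (R *ᵥ y) := by
    simp only [dotProduct, sq]
  have hJ : allOnes _ _ *ᵥ y = fun _ : Fin v => ∑ i, y i := by
    ext i; simp [mulVec, dotProduct]
  rw [h1, dotProduct_mulVec, vecMul_mulVec, ← mulVec_transpose, transpose_mul, transpose_transpose,
    hR, add_mulVec, smul_mulVec, smul_mulVec, one_mulVec, hJ]
  simp only [dotProduct, Pi.add_apply, Pi.smul_apply, smul_eq_mul, add_mul, Finset.sum_add_distrib,
    Finset.mul_sum]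
  congr 1
  · exact Finset.sum_congr rfl fun _ _ => by ring
  · simp only [Finset.sum_mul, Finset.mul_sum, sq, mul_assoc]

/-- The case `v ≡ 1 (mod 4)`. -/
theorem exists_zero_of_four_dvd {N μ : ℕ} (hN : 4 ∣ N) (hμ : 0 < μ) {w : ℚ}
    {R : Matrix (Fin (N + 1)) (Fin (N + 1)) ℚ}
    (hR : Rᵀ * R = (μ : ℚ) • (1 : Matrix (Fin (N + 1)) (Fin (N + 1)) ℚ)
      + (((N : ℚ) + 1) * w ^ 2) • allOnes _ _) :
    ∃ x y z : ℚ, x ≠ 0 ∧ μ * x ^ 2 + ((N : ℚ) + 1) * y ^ 2 = z ^ 2 := by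
  obtain ⟨c, hc⟩ := exists_similarity_of_four_dvd μ N hN
  let π : (Fin (N + 1) → ℚ) →ₗ[ℚ] (Fin N → ℚ) := LinearMap.funLeft ℚ ℚ Fin.castSucc
  have hμ' : (0 : ℚ) < μ := by exact_mod_cast hμ
  obtain ⟨y, hy0, hy⟩ := exists_cancel_squares
    (f := fun i : Fin N => LinearMap.proj i ∘ₗ c ∘ₗ π)
    (g := fun i : Fin N => LinearMap.proj i.castSucc ∘ₗ R.mulVecLin)
    (h := LinearMap.proj (Fin.last N)) (by
      intro x h1 h2
      have h3 := hc (π x)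
      have h4 : ∀ i, c (π x) i = 0 := fun i => by simpa using h1 i
      simp only [h4] at h3
      have h5 : ∑ i, π x i ^ 2 = 0 := by
        rcases mul_eq_zero.mp (h3.symm.trans (by simp)) with h | h
        · exact absurd h hμ'.ne'
        · exact h
      rw [Finset.sum_eq_zero_iff_of_nonneg (fun _ _ => sq_nonneg _)] at h5
      ext i
      refine Fin.lastCases ?_ (fun j => ?_) i
      · simpa using h2
      · have := h5 j (Finset.mem_univ _)
        simpa [π, LinearMap.funLeft_apply] using this) (by simp)
  -- Only the last coordinate of `y` and of `R *ᵥ y` survive the cancellation of `N` squares.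
  refine ⟨y (Fin.last N), w * ∑ i, y i, (R *ᵥ y) (Fin.last N), by simpa using hy0, ?_⟩
  have h1 := sum_mulVec_sq hR y
  rw [Fin.sum_univ_castSucc, Fin.sum_univ_castSucc (f := fun i => y i ^ 2), mul_add] at h1
  have h2 := hc (π y)
  have h3 : ∑ i, c (π y) i ^ 2 = ∑ i : Fin N, (R *ᵥ y) i.castSucc ^ 2 :=
    Finset.sum_congr rfl fun i _ => by simpa using hy i
  have h4 : ∑ i, π y i ^ 2 = ∑ i : Fin N, y i.castSucc ^ 2 := rfl
  rw [h3, h4] at h2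
  linear_combination -h1 + h2

/-- The case `v ≡ 3 (mod 4)`. -/
theorem exists_zero_of_four_dvd_succ {v μ : ℕ} (hv : 4 ∣ v + 1) (hμ : 0 < μ) {w : ℚ}
    {R : Matrix (Fin v) (Fin v) ℚ}
    (hR : Rᵀ * R = (μ : ℚ) • (1 : Matrix (Fin v) (Fin v) ℚ)
      + ((v : ℚ) * w ^ 2) • allOnes _ _) :
    ∃ x y z : ℚ, z ≠ 0 ∧ μ * x ^ 2 + (-(v : ℚ)) * y ^ 2 = z ^ 2 := by
  obtain ⟨c, hc⟩ := exists_similarity_of_four_dvd μ (v + 1) hv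
  let π : (Fin (v + 1) → ℚ) →ₗ[ℚ] (Fin v → ℚ) := LinearMap.funLeft ℚ ℚ Fin.castSucc
  have hμ' : (0 : ℚ) < μ := by exact_mod_cast hμ
  -- One auxiliary variable, ignored by `R`, raises the dimension to a multiple of four. The
  -- uncancelled form is the last coordinate of `c y`, so here it is `z` that is nonzero.
  obtain ⟨y, hy0, hy⟩ := exists_cancel_squares
    (f := fun i : Fin v => LinearMap.proj i.castSucc ∘ₗ c)
    (g := fun i : Fin v => LinearMap.proj i ∘ₗ R.mulVecLin ∘ₗ π)
    (h := LinearMap.proj (Fin.last v) ∘ₗ c) (by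
      intro x h1 h2
      have h3 := hc x
      have h4 : ∀ i, c x i = 0 := fun i =>
        Fin.lastCases (by simpa using h2) (fun j => by simpa using h1 j) i
      simp only [h4] at h3
      have h5 : ∑ i, x i ^ 2 = 0 := by
        rcases mul_eq_zero.mp (h3.symm.trans (by simp)) with h | h
        · exact absurd h hμ'.ne'
        · exact h
      rw [Finset.sum_eq_zero_iff_of_nonneg (fun _ _ => sq_nonneg _)] at h5
      ext i
      simpa using h5 i (Finset.mem_univ _)) (by simp)
  refine ⟨y (Fin.last v), w * ∑ i, π y i, c y (Fin.last v), by simpa using hy0, ?_⟩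
  have h1 := sum_mulVec_sq hR (π y)
  have h2 := hc y
  rw [Fin.sum_univ_castSucc, Fin.sum_univ_castSucc (f := fun i => y i ^ 2), mul_add] at h2
  have h3 : ∑ i : Fin v, c y i.castSucc ^ 2 = ∑ i : Fin v, (R *ᵥ π y) i ^ 2 :=
    Finset.sum_congr rfl fun i _ => by simpa using hy i
  have h4 : ∑ i, π y i ^ 2 = ∑ i : Fin v, y i.castSucc ^ 2 := rfl
  rw [h4] at h1
  rw [h3] at h2
  linear_combination h1 - h2

/-- The case of even `v`. -/
theorem isSquare_of_transpose_mul_self {v μ : ℕ} (hv : Even v) (hv0 : 0 < v) (hμ : 0 < μ)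
    {γ t : ℚ} (ht : t ≠ 0) (hγ : μ + v * γ = t ^ 2) {R : Matrix (Fin v) (Fin v) ℚ}
    (hR : Rᵀ * R = (μ : ℚ) • (1 : Matrix (Fin v) (Fin v) ℚ) + γ • allOnes _ _) :
    IsSquare μ := by
  have hμ' : (μ : ℚ) ≠ 0 := by exact_mod_cast hμ.ne'
  have h1 : Rᵀ * R = (μ : ℚ) • (1 + replicateCol Unit (fun _ => γ / μ)
      * replicateRow Unit (fun _ : Fin v => (1 : ℚ))) := by
    rw [hR]
    ext i j
    simp [Matrix.mul_apply]
    field_simp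
  have h2 := congrArg det h1
  rw [det_mul, det_transpose, det_smul, det_one_add_replicateCol_mul_replicateRow] at h2
  obtain ⟨j, rfl⟩ : ∃ j, v = 2 * j + 2 := by
    obtain ⟨i, rfl⟩ := hv
    exact ⟨i - 1, by omega⟩
  simp [dotProduct] at h2
  rw [← Rat.isSquare_natCast_iff]
  -- The determinant of the rank-one perturbation gives `det R ^ 2 = μ ^ (v - 1) * t ^ 2`, with `v -
  -- 1 = 2 * j + 1` odd.
  refine ⟨R.det / (t * μ ^ j), ?_⟩
  have h3 : R.det * R.det = μ * (μ ^ j) ^ 2 * t ^ 2 := by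
    rw [h2, ← hγ]
    push_cast
    field_simp
    ring
  field_simp
  linear_combination -h3

/-! ### Gram matrices modulo the all-ones matrix -/

section Gram

variable {P F B : Type*} [Fintype B]

theorem allOnes_mul_allOnes (X Y : Type*) :
    allOnes X B * allOnes B Y = (Fintype.card B : ℚ) • allOnes X Y := by
  ext i j; simp [Matrix.mul_apply]

theorem mul_allOnes {N : Matrix P B ℚ} {r : ℚ} (h : ∀ p, ∑ i, N p i = r) (X : Type*) :
    N * allOnes B X = r • allOnes P X := by
  ext p j; simp [Matrix.mul_apply, h]

theorem allOnes_mul {P B : Type*} [Fintype P] {N : Matrix P B ℚ} {k : ℚ} (h : ∀ i, ∑ p, N p i = k) (X : Type*) :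
    allOnes X P * N = k • allOnes X B := by
  ext p j; simp [Matrix.mul_apply, h]

variable [Fintype P] [Fintype F]

/-- Regrouping as `Nᵀ (N Nᵀ) N` carries the point-side identity to the blocks: on vectors of sum
zero, the only possible eigenvalues are `0` and `a`. -/
theorem gram_mul_self [DecidableEq P] {N : Matrix P B ℚ} {a l k : ℚ}
    (h : N * Nᵀ = a • (1 : Matrix P P ℚ) + l • allOnes P P) (hk : ∀ i, ∑ p, N p i = k) :
    (Nᵀ * N) * (Nᵀ * N) = a • (Nᵀ * N) + (l * k ^ 2) • allOnes B B := by
  have h1 : Nᵀ * allOnes P B = k • allOnes B B := mul_allOnes (N := Nᵀ) hk B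
  calc (Nᵀ * N) * (Nᵀ * N) = Nᵀ * (N * Nᵀ) * N := by simp only [Matrix.mul_assoc]
    _ = a • (Nᵀ * N) + l • (Nᵀ * (allOnes P P * N)) := by
      rw [h]
      simp only [Matrix.mul_add, Matrix.add_mul, Matrix.mul_assoc, Matrix.smul_mul,
        Matrix.mul_smul, Matrix.one_mul]
    _ = _ := by
      rw [allOnes_mul hk, Matrix.mul_smul, h1, smul_smul, smul_smul]
      congr 2; ring

theorem gram_mul_allOnes {N : Matrix P B ℚ} {r k : ℚ} (hr : ∀ p, ∑ i, N p i = r)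
    (hk : ∀ i, ∑ p, N p i = k) :
    (Nᵀ * N) * allOnes B B = (r * k) • allOnes B B := by
  have h1 : Nᵀ * allOnes P B = k • allOnes B B := mul_allOnes (N := Nᵀ) hk B
  rw [Matrix.mul_assoc, mul_allOnes hr, Matrix.mul_smul, h1, smul_smul]

theorem allOnes_mul_gram {N : Matrix P B ℚ} {r k : ℚ} (hr : ∀ p, ∑ i, N p i = r)
    (hk : ∀ i, ∑ p, N p i = k) :
    allOnes B B * (Nᵀ * N) = (r * k) • allOnes B B := by
  have h1 : allOnes B P * N = k • allOnes B B := allOnes_mul hk B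
  have h2 : allOnes B B * Nᵀ = r • allOnes B P := allOnes_mul (N := Nᵀ) hr B
  rw [← Matrix.mul_assoc, h2, Matrix.smul_mul, h1, smul_smul]

/-- Comparing the quadratic relations of two Gram matrices that are related by an affine
relation modulo `allOnes`. -/
theorem gram_coefficients [DecidableEq B] {S T : Matrix B B ℚ} {a a' e e' d μ c l₁ n : ℚ}
    (hS : S * S = a • S + e • allOnes B B) (hT : T * T = a' • T + e' • allOnes B B)
    (hSJ : S * allOnes B B = d • allOnes B B) (hJS : allOnes B B * S = d • allOnes B B)
    (hTS : T = μ • S + c • (1 : Matrix B B ℚ) + l₁ • allOnes B B)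
    (hn : ∀ i, S i i = n) {i j i' j' : B} (hij : i ≠ j) (hSij : S i j = 1)
    (hij' : i' ≠ j') (hSij' : S i' j' = 0) :
    μ ^ 2 * a + 2 * μ * c = a' * μ ∧ c ^ 2 = a' * c := by
  have key : (μ ^ 2 * a + 2 * μ * c - a' * μ) • S + (c ^ 2 - a' * c) • (1 : Matrix B B ℚ)
      + (μ ^ 2 * e + 2 * μ * l₁ * d + 2 * c * l₁ + l₁ ^ 2 * Fintype.card B - a' * l₁ - e') •
        allOnes B B = 0 := by
    have h1 : T * T = μ ^ 2 • (S * S) + (2 * μ * c) • S + (μ * l₁) • (S * allOnes B B)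
        + (μ * l₁) • (allOnes B B * S) + c ^ 2 • (1 : Matrix B B ℚ) + (2 * c * l₁) • allOnes B B
        + l₁ ^ 2 • (allOnes B B * allOnes B B) := by
      rw [hTS]
      simp only [Matrix.add_mul, Matrix.mul_add, Matrix.smul_mul, Matrix.mul_smul, Matrix.one_mul,
        Matrix.mul_one, smul_add, smul_smul]
      module
    rw [hT, hTS, hS, hSJ, hJS, allOnes_mul_allOnes] at h1
    rw [← sub_eq_zero] at h1
    rw [← neg_eq_zero, ← h1]
    module
  -- The entry with `S = 0` kills the coefficient of `allOnes`, the entry with `S = 1` that of `S`,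
  -- and a diagonal entry that of the identity.
  have k0 := congrFun (congrFun key i') j'
  have k1 := congrFun (congrFun key i) j
  have k2 := congrFun (congrFun key i) i
  simp only [Matrix.add_apply, Matrix.smul_apply, Matrix.of_apply, smul_eq_mul, Matrix.zero_apply,
    hSij', hSij, hn, Matrix.one_apply_ne hij, Matrix.one_apply_ne hij', Matrix.one_apply_eq]
    at k0 k1 k2
  have h0 : μ ^ 2 * a + 2 * μ * c - a' * μ = 0 := by linarith
  rw [h0] at k2
  constructor <;> linarith

/-- The rational matrix of square type built from two block-equivalent designs. -/
theorem exists_square_matrix [DecidableEq F] {N : Matrix P B ℚ} {M : Matrix F B ℚ}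
    {μ l₁ m n k v : ℚ} (hm : m - 1 ≠ 0) (hv : v ≠ 0)
    (hF : (Fintype.card F : ℚ) = v) (hP : (Fintype.card P : ℚ) = v)
    (hG : Nᵀ * N = μ • (Mᵀ * M) + l₁ • allOnes B B)
    (hM : M * Mᵀ = (m - 1) • (1 : Matrix F F ℚ) + (1 : ℚ) • allOnes F F)
    (hMr : ∀ q, ∑ i, M q i = m) (hNk : ∀ i, ∑ p, N p i = k)
    (hvm : v = m * n - m + 1) (hk : k ^ 2 = μ * n ^ 2 + l₁ * v) :
    ∃ R : Matrix P F ℚ, Rᵀ * R = μ • (1 : Matrix F F ℚ)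
      + (v * ((μ - 1) / (2 * v)) ^ 2) • allOnes F F := by
  have h1 : (N * Mᵀ)ᵀ * (N * Mᵀ) = (μ * (m - 1) ^ 2) • (1 : Matrix F F ℚ)
      + (μ * (2 * (m - 1) + v) + l₁ * m ^ 2) • allOnes F F := by
    have e1 : (N * Mᵀ)ᵀ * (N * Mᵀ) = M * (Nᵀ * N) * Mᵀ := by
      simp only [Matrix.transpose_mul, Matrix.transpose_transpose, Matrix.mul_assoc]
    have e2 : M * (Nᵀ * N) * Mᵀ = μ • ((M * Mᵀ) * (M * Mᵀ))
        + l₁ • ((M * allOnes B B) * Mᵀ) := by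
      rw [hG]
      simp only [Matrix.mul_add, Matrix.add_mul, Matrix.mul_smul, Matrix.smul_mul,
        Matrix.mul_assoc]
    have e3 : allOnes F B * Mᵀ = m • allOnes F F := allOnes_mul (N := Mᵀ) hMr F
    rw [e1, e2, hM, mul_allOnes hMr, Matrix.smul_mul, e3]
    simp only [Matrix.add_mul, Matrix.mul_add, Matrix.smul_mul, Matrix.mul_smul, Matrix.one_mul,
        Matrix.mul_one, smul_add, smul_smul, allOnes_mul_allOnes, hF]
    module
  have hJ : allOnes F P * (N * Mᵀ) = (k * m) • allOnes F F := by
    have e3 : allOnes F B * Mᵀ = m • allOnes F F := allOnes_mul (N := Mᵀ) hMr F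
    rw [← Matrix.mul_assoc, allOnes_mul hNk, Matrix.smul_mul, e3, smul_smul]
  have hJ' : (N * Mᵀ)ᵀ * allOnes P F = (k * m) • allOnes F F := by
    have := congrArg transpose hJ
    rwa [Matrix.transpose_mul] at this
  set Q := N * Mᵀ with hQ
  -- This makes every column sum of the new matrix `(μ + 1) / 2`. If `γ` is its `allOnes`
  -- coefficient, then `μ + v * γ = ((μ + 1) / 2) ^ 2` and `v * γ = ((μ - 1) / 2) ^ 2` are both
  -- squares, as the determinant and elimination arguments need.
  let β : ℚ := ((μ + 1) / 2 - k * m / (m - 1)) / v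
  refine ⟨(m - 1)⁻¹ • Q + β • allOnes P F, ?_⟩
  have h2 : ((m - 1)⁻¹ • Q + β • allOnes P F)ᵀ * ((m - 1)⁻¹ • Q + β • allOnes P F)
      = ((m - 1)⁻¹ ^ 2) • (Qᵀ * Q) + ((m - 1)⁻¹ * β) • (Qᵀ * allOnes P F)
        + ((m - 1)⁻¹ * β) • (allOnes F P * Q) + (β ^ 2) • (allOnes F P * allOnes P F) := by
    have e : (allOnes P F)ᵀ = allOnes F P := rfl
    rw [Matrix.transpose_add, Matrix.transpose_smul, Matrix.transpose_smul, e]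
    simp only [Matrix.add_mul, Matrix.mul_add, Matrix.smul_mul, Matrix.mul_smul, smul_add,
      smul_smul]
    module
  rw [h2, h1, hJ, hJ', allOnes_mul_allOnes, hP]
  simp only [smul_add, smul_smul]
  have c1 : (m - 1)⁻¹ ^ 2 * (μ * (m - 1) ^ 2) = μ := by field_simp
  have c2 : (m - 1)⁻¹ ^ 2 * (μ * (2 * (m - 1) + v) + l₁ * m ^ 2) + (m - 1)⁻¹ * β * (k * m)
      + (m - 1)⁻¹ * β * (k * m) + β ^ 2 * v = v * ((μ - 1) / (2 * v)) ^ 2 := by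
    have hβ : β * v = (μ + 1) / 2 - k * m / (m - 1) := by simp only [β]; field_simp
    have h3 : k * m / (m - 1) = (μ + 1) / 2 - β * v := by rw [hβ]; ring
    have h4 : v * ((m - 1)⁻¹ ^ 2 * (μ * (2 * (m - 1) + v) + l₁ * m ^ 2)) =
        (k * m / (m - 1)) ^ 2 - μ := by
      field_simp
      have : m * n = m - 1 + v := by rw [hvm]; ring
      linear_combination -m ^ 2 * hk - μ * (m * n + m - 1 + v) * this
    apply mul_left_cancel₀ hv
    have h5 : (m - 1)⁻¹ * β * (k * m) = β * (k * m / (m - 1)) := by field_simp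
    rw [h5, mul_add, mul_add, mul_add, h4, h3]
    field_simp
    ring
  rw [c1, ← c2]
  module

end Gram

/-! ### Incidence matrices of 2-designs -/

namespace IncidenceSystem

variable {P B : Type*} [DecidableEq P]

/-- The rational point-block incidence matrix. -/
def incMatrix (D : IncidenceSystem P B) : Matrix P B ℚ :=
  Matrix.of fun p i => if p ∈ D.block i then 1 else 0

theorem transpose_incMatrix_mul [Fintype P] (D : IncidenceSystem P B) (i j : B) :
    (D.incMatrixᵀ * D.incMatrix) i j = (D.block i ∩ D.block j).card := by
  simp [Matrix.mul_apply, incMatrix, Finset.inter_comm]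

theorem incMatrix_mul_transpose [Fintype B] (D : IncidenceSystem P B) (p q : P) :
    (D.incMatrix * D.incMatrixᵀ) p q =
      (Finset.univ.filter (fun i : B => p ∈ D.block i ∧ q ∈ D.block i)).card := by
  simp [Matrix.mul_apply, incMatrix, ← ite_and, and_comm]

namespace IsTwoDesign

variable [Fintype P] [Fintype B] {D : IncidenceSystem P B} {v k l : ℕ}

theorem sum_incMatrix_col (hD : D.IsTwoDesign v k l) (i : B) : ∑ p, D.incMatrix p i = k := by
  simp [incMatrix, hD.card_block i]

/-- Double counting of pairs of a point and a block containing it and `p`. For `k = 1` the identity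
says nothing about the row sum, which is why blocks with at least two points are needed later. -/
theorem replication (hD : D.IsTwoDesign v k l) (p : P) :
    (∑ i, D.incMatrix p i) * ((k : ℚ) - 1) = l * ((v : ℚ) - 1) := by
  have h1 : ∑ q, (D.incMatrix * D.incMatrixᵀ) p q = (∑ i, D.incMatrix p i) * k := by
    simp only [Matrix.mul_apply, Matrix.transpose_apply]
    rw [Finset.sum_comm, Finset.sum_mul]
    exact Finset.sum_congr rfl fun i _ => by rw [← Finset.mul_sum, hD.sum_incMatrix_col]
  have h2 : (D.incMatrix * D.incMatrixᵀ) p p = ∑ i, D.incMatrix p i := by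
    rw [incMatrix_mul_transpose]
    simp [incMatrix]
  have h3 : ∑ q ∈ Finset.univ.erase p, (D.incMatrix * D.incMatrixᵀ) p q = l * ((v : ℚ) - 1) := by
    rw [Finset.sum_congr rfl (g := fun _ => (l : ℚ))]
    · have hv : 1 ≤ v := by
        rw [← hD.card_points]; exact Fintype.card_pos_iff.mpr ⟨p⟩
      rw [Finset.sum_const, Finset.card_erase_of_mem (Finset.mem_univ p), Finset.card_univ,
        hD.card_points, nsmul_eq_mul, Nat.cast_sub hv]
      push_cast; ring
    · intro q hq
      rw [incMatrix_mul_transpose, hD.balance p q (Finset.ne_of_mem_erase hq).symm]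
  rw [← Finset.add_sum_erase _ _ (Finset.mem_univ p), h2, h3] at h1
  linarith

theorem exists_replication (hD : D.IsTwoDesign v k l) (hk : 2 ≤ k) :
    ∃ r : ℚ, r * ((k : ℚ) - 1) = l * ((v : ℚ) - 1) ∧ ∀ p, ∑ i, D.incMatrix p i = r := by
  have hk' : (k : ℚ) - 1 ≠ 0 := by
    have : (2 : ℚ) ≤ k := by exact_mod_cast hk
    linarith
  refine ⟨l * ((v : ℚ) - 1) / (k - 1), by field_simp, fun p => ?_⟩
  rw [eq_div_iff hk', hD.replication p]

theorem incMatrix_mul_transpose_eq (hD : D.IsTwoDesign v k l) {r : ℚ}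
    (hr : ∀ p, ∑ i, D.incMatrix p i = r) :
    D.incMatrix * D.incMatrixᵀ = (r - l) • (1 : Matrix P P ℚ) + (l : ℚ) • allOnes P P := by
  ext p q
  rw [incMatrix_mul_transpose]
  by_cases h : p = q
  · subst h
    have := hr p
    simp only [incMatrix, Matrix.of_apply, Finset.sum_boole] at this
    simp [this]
  · simp [hD.balance p q h, h]

theorem card_mul_replication (hD : D.IsTwoDesign v k l) {r : ℚ}
    (hr : ∀ p, ∑ i, D.incMatrix p i = r) : (Fintype.card B : ℚ) * k = v * r := by
  have h := Finset.sum_comm (s := Finset.univ) (t := Finset.univ) (f := fun p i => D.incMatrix p i)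
  simp only [hr, hD.sum_incMatrix_col] at h
  simpa [hD.card_points] using h.symm

theorem le_replication (hD : D.IsTwoDesign v k l) {r : ℚ}
    (hr : ∀ p, ∑ i, D.incMatrix p i = r) {p q : P} (hpq : p ≠ q) : (l : ℚ) ≤ r := by
  have := hr p
  simp only [incMatrix, Matrix.of_apply, Finset.sum_boole] at this
  rw [← this, ← hD.balance p q hpq]
  exact_mod_cast Finset.card_le_card (fun i hi => by
    simp only [Finset.mem_filter, Finset.mem_univ, true_and] at hi ⊢
    exact hi.1)

end IsTwoDesign

end IncidenceSystem

/-! ### Comparison of the two designs -/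

namespace IncidenceSystem

variable {P F B : Type*} [Fintype P] [DecidableEq P] [Fintype F] [DecidableEq F] [Fintype B]

/-- If the intersection sizes of `D` are an affine function of those of a Steiner system having
both disjoint and intersecting blocks, then the blocks of `D` have at least two points. -/
theorem two_le_card_block {D : IncidenceSystem P B} {S : IncidenceSystem F B} {v k l w n : ℕ}
    (hD : D.IsTwoDesign v k l) (hS : S.IsTwoDesign w n 1) (hn : 0 < n) {l₁ μ : ℕ} (hμ : 0 < μ)
    (hrel : ∀ i j, i ≠ j → (D.block i ∩ D.block j).card = l₁ + μ * (S.block i ∩ S.block j).card)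
    {i j i' j' : B} (hij : i ≠ j) (hSij : (S.block i ∩ S.block j).card = 1)
    (hij' : i' ≠ j') (hSij' : (S.block i' ∩ S.block j').card = 0) : 2 ≤ k := by
  by_contra! hk
  have hle := Finset.card_le_card (Finset.inter_subset_left : D.block i ∩ D.block j ⊆ _)
  rw [hD.card_block, hrel i j hij, hSij] at hle
  have hk1 : k = 1 := by omega
  have hdisj := Finset.card_eq_zero.mp hSij'
  have heq : ∀ x y, x ≠ y → ∀ p ∈ S.block x, p ∈ S.block y → D.block x = D.block y := by
    intro x y hxy p hx hy
    have h1 : 0 < (S.block x ∩ S.block y).card :=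
      Finset.card_pos.mpr ⟨p, Finset.mem_inter.mpr ⟨hx, hy⟩⟩
    have h2 : 1 ≤ (D.block x ∩ D.block y).card := by
      rw [hrel x y hxy]
      have := Nat.mul_pos hμ h1
      omega
    have h3 : D.block x ∩ D.block y = D.block x :=
      Finset.eq_of_subset_of_card_le Finset.inter_subset_left (by rw [hD.card_block]; omega)
    have h4 : D.block x ∩ D.block y = D.block y :=
      Finset.eq_of_subset_of_card_le Finset.inter_subset_right (by rw [hD.card_block]; omega)
    exact h3.symm.trans h4
  obtain ⟨p, hp⟩ := Finset.card_pos.mp (by rw [hS.card_block i']; exact hn)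
  obtain ⟨q, hq⟩ := Finset.card_pos.mp (by rw [hS.card_block j']; exact hn)
  have hpj : p ∉ S.block j' := fun h => by
    have := Finset.mem_inter.mpr ⟨hp, h⟩
    simp [hdisj] at this
  have hqi : q ∉ S.block i' := fun h => by
    have := Finset.mem_inter.mpr ⟨h, hq⟩
    simp [hdisj] at this
  have hpq : p ≠ q := fun h => hpj (h ▸ hq)
  -- The Steiner block through `p` and `q` meets both disjoint blocks, so all three have the same
  -- one-point `D`-block; yet `l₁ + μ ≤ 1` forces `l₁ = 0`.
  obtain ⟨x, hx⟩ := Finset.card_pos.mp (by rw [hS.balance p q hpq]; exact one_pos)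
  simp only [Finset.mem_filter, Finset.mem_univ, true_and] at hx
  have hxi : x ≠ i' := fun h => hqi (h ▸ hx.2)
  have hxj : x ≠ j' := fun h => hpj (h ▸ hx.1)
  have h1 := heq x i' hxi p hx.1 hp
  have h2 := heq x j' hxj q hx.2 hq
  have h3 := hrel i' j' hij'
  rw [← h1, ← h2, Finset.inter_self, hD.card_block, hSij'] at h3
  omega

/-- A design whose intersection sizes are `l₁ + μ *` those of a Steiner design with replication
number `m` has as many points as the latter, and a suitable rational matrix is a similarity with
factor `μ` up to a multiple of `allOnes`. -/
theorem exists_similarity_matrix {D : IncidenceSystem P B} {S : IncidenceSystem F B}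
    {v k l w n m : ℕ} (hD : D.IsTwoDesign v k l) (hS : S.IsTwoDesign w n 1) (hn : 2 ≤ n)
    (hm : 2 ≤ m) (hw : (w : ℚ) = m * n - m + 1) {l₁ μ : ℕ} (hμ : 0 < μ)
    (hrel : ∀ i j, i ≠ j → (D.block i ∩ D.block j).card = l₁ + μ * (S.block i ∩ S.block j).card)
    {i j i' j' : B} (hij : i ≠ j) (hSij : (S.block i ∩ S.block j).card = 1)
    (hij' : i' ≠ j') (hSij' : (S.block i' ∩ S.block j').card = 0) :
    v = w ∧ ∃ R : Matrix P F ℚ, Rᵀ * R = (μ : ℚ) • (1 : Matrix F F ℚ)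
      + (w * (((μ : ℚ) - 1) / (2 * w)) ^ 2) • allOnes F F := by
  classical
  have hk := two_le_card_block hD hS (by omega) hμ hrel hij hSij hij' hSij'
  have hn' : (2 : ℚ) ≤ n := by exact_mod_cast hn
  have hm' : (2 : ℚ) ≤ m := by exact_mod_cast hm
  have hμ' : (0 : ℚ) < μ := by exact_mod_cast hμ
  obtain ⟨r, hr1, hr⟩ := hD.exists_replication hk
  obtain ⟨s, hs1, hs⟩ := hS.exists_replication hn
  obtain rfl : s = m := by
    have : (s - m) * ((n : ℚ) - 1) = 0 := by
      rw [hw] at hs1; push_cast at hs1; linear_combination hs1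
    rcases mul_eq_zero.mp this with h | h <;> linarith
  have hlr : (l : ℚ) ≤ r := by
    obtain ⟨p, -, q, -, hpq⟩ := Finset.one_lt_card.mp
      (show 1 < (D.block i).card by rw [hD.card_block]; omega)
    exact hD.le_replication hr hpq
  have hDk := hD.sum_incMatrix_col
  have hSn := hS.sum_incMatrix_col
  have hM := hS.incMatrix_mul_transpose_eq hs
  have hT := gram_mul_self (hD.incMatrix_mul_transpose_eq hr) hDk
  have hSS := gram_mul_self hM hSn
  have hSJ := gram_mul_allOnes hs hSn
  have hTS : D.incMatrixᵀ * D.incMatrix = (μ : ℚ) • (S.incMatrixᵀ * S.incMatrix)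
      + ((k : ℚ) - μ * n - l₁) • (1 : Matrix B B ℚ) + (l₁ : ℚ) • allOnes B B := by
    ext x y
    simp only [Matrix.add_apply, Matrix.smul_apply, smul_eq_mul, transpose_incMatrix_mul,
      Matrix.of_apply]
    by_cases hxy : x = y
    · subst hxy
      simp only [Finset.inter_self, hD.card_block, hS.card_block, Matrix.one_apply_eq]
      ring
    · rw [hrel x y hxy, Matrix.one_apply_ne hxy]
      push_cast; ring
  obtain ⟨e1, e2⟩ := gram_coefficients (n := (n : ℚ)) hSS hT hSJ (allOnes_mul_gram hs hSn) hTS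
    (fun x => by simp [transpose_incMatrix_mul, hS.card_block]) hij
    (by simp [transpose_incMatrix_mul, hSij]) hij' (by simp [transpose_incMatrix_mul, hSij'])
  set c : ℚ := (k : ℚ) - μ * n - l₁ with hc
  have e3 : (μ : ℚ) * (m - 1) + 2 * c = r - l := by
    apply mul_left_cancel₀ hμ'.ne'
    push_cast at e1
    linear_combination e1
  -- The other root `c = r - l` would give `μ * (m - 1) = -(r - l) ≤ 0`.
  have hc0 : c = 0 := by
    have h1 : c * (c - (r - l)) = 0 := by linear_combination e2
    rcases mul_eq_zero.mp h1 with h | h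
    · exact h
    · have : 0 < (μ : ℚ) * (m - 1) := mul_pos hμ' (by linarith)
      linarith
  rw [hc0] at e3 hTS
  rw [zero_smul, add_zero] at hTS
  have hrow : r * k = μ * (m * n) + l₁ * Fintype.card B := by
    have h1 := congrFun (congrFun (gram_mul_allOnes hr hDk) i) i
    rw [hTS, Matrix.add_mul, Matrix.smul_mul, hSJ, Matrix.smul_mul, allOnes_mul_allOnes] at h1
    simpa using h1.symm
  have hb := hD.card_mul_replication hr
  have hb' := hS.card_mul_replication hs
  -- With `b` blocks, `(v - 1) * (r - l) = b * k - r * k` is the trace of the Gram matrix minus its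
  -- eigenvalue on the all-ones vector. Passing from the Steiner design to `D` multiplies this by
  -- `μ`, and `r - l = μ * (m - 1)`.
  have hvw : (v : ℚ) = w := by
    have h1 : (μ * ((m : ℚ) - 1)) * (v - w) = 0 := by
      linear_combination (v - 1) * e3 + hr1 - hb - hrow + (Fintype.card B : ℚ) * (hc0 - hc)
        + μ * hb' + μ * hw
    rcases mul_eq_zero.mp h1 with h | h
    · exact absurd h (mul_pos hμ' (by linarith)).ne'
    · linarith
  have hw0 : (w : ℚ) ≠ 0 := by rw [hw]; nlinarith
  have hmk : (m : ℚ) * k = r * n := by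
    apply mul_left_cancel₀ hw0
    rw [hvw] at hb
    linear_combination n * hb - k * hb'
  refine ⟨by exact_mod_cast hvw, exists_square_matrix (m := m) (n := n) (k := k) (by linarith) hw0
    (by rw [hS.card_points]) (by rw [hD.card_points, hvw]) hTS (by simpa using hM) hs hDk hw ?_⟩
  apply mul_left_cancel₀ (show (m : ℚ) ≠ 0 by linarith)
  linear_combination k * hmk + n * hrow + l₁ * hb'

end IncidenceSystem

/-! ### Arithmetic conclusion by the residue of `v` modulo 4 -/

/-- Arithmetic consequences of a rational matrix `R` with `RᵀR = μ I + v w² J`. -/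
theorem isSquare_and_exists_zero {v μ : ℕ} (hv : 0 < v) (hμ : 0 < μ) {w : ℚ}
    (hw : w = ((μ : ℚ) - 1) / (2 * v)) {R : Matrix (Fin v) (Fin v) ℚ}
    (hR : Rᵀ * R = (μ : ℚ) • (1 : Matrix (Fin v) (Fin v) ℚ) + (v * w ^ 2) • allOnes _ _) :
    (Even v → IsSquare μ) ∧ ∃ x y z : ℤ, (x, y, z) ≠ (0, 0, 0) ∧
      (μ : ℤ) * x ^ 2 + (-1) ^ ((v - 1).choose 2) * v * y ^ 2 = z ^ 2 := by
  have hv' : (v : ℚ) ≠ 0 := by exact_mod_cast hv.ne'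
  have hμ' : (0 : ℚ) < μ := by exact_mod_cast hμ
  have hsq : Even v → IsSquare μ := fun hev =>
    isSquare_of_transpose_mul_self hev hv hμ (t := ((μ : ℚ) + 1) / 2)
      (by positivity) (by rw [hw]; field_simp; ring) hR
  refine ⟨hsq, ?_⟩
  rcases Nat.even_or_odd v with hev | hodd
  · obtain ⟨a, rfl⟩ := hsq hev
    exact ⟨1, 0, a, by simp, by push_cast; ring⟩
  obtain ⟨t, ht | ht⟩ : ∃ t, v = 4 * t + 1 ∨ v = 4 * t + 3 := ⟨v / 4, by
    obtain ⟨a, rfl⟩ := hodd; omega⟩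
  · have hch : Even ((v - 1).choose 2) := by
      have : (v - 1).choose 2 = 2 * (t * (4 * t - 1)) := by
        rw [ht, Nat.choose_two_right, Nat.add_sub_cancel]
        exact Nat.div_eq_of_eq_mul_left two_pos (by ring)
      exact this ▸ even_two_mul _
    rw [hch.neg_one_pow, one_mul]
    subst ht
    obtain ⟨x, y, z, hx, h⟩ := exists_zero_of_four_dvd (N := 4 * t) ⟨t, rfl⟩ hμ (w := w) (R := R)
      (by push_cast at hR ⊢; exact hR)
    exact exists_int_ternary_zero (x := x) (y := y) (z := z) (Or.inl hx)
      (by push_cast at h ⊢; exact h)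
  · have hch : Odd ((v - 1).choose 2) := by
      have : (v - 1).choose 2 = (2 * t + 1) * (4 * t + 1) := by
        rw [ht, Nat.choose_two_right, show 4 * t + 3 - 1 = 4 * t + 2 by omega,
          show 4 * t + 2 - 1 = 4 * t + 1 by omega]
        exact Nat.div_eq_of_eq_mul_left two_pos (by ring)
      rw [this]
      exact Odd.mul ⟨t, rfl⟩ ⟨2 * t, by ring⟩
    rw [hch.neg_one_pow, neg_one_mul]
    obtain ⟨x, y, z, hz, h⟩ := exists_zero_of_four_dvd_succ ⟨t + 1, by omega⟩ hμ hR
    exact exists_int_ternary_zero (x := x) (y := y) (z := z) (Or.inr hz) (by push_cast; exact h)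

/-! ### Matching the blocks and the final statement -/

namespace IncidenceSystem

/-- Relabelling the blocks of a design. -/
theorem IsTwoDesign.comp_equiv {P B B' : Type*} [Fintype P] [DecidableEq P] [Fintype B]
    [Fintype B'] {D : IncidenceSystem P B} {v k l : ℕ} (hD : D.IsTwoDesign v k l) (e : B' ≃ B) :
    IsTwoDesign (⟨fun i => D.block (e i)⟩ : IncidenceSystem P B') v k l where
  card_points := hD.card_points
  card_block i := hD.card_block (e i)
  balance x y hxy := by
    rw [← hD.balance x y hxy]
    exact Finset.card_equiv e (by simp)

theorem IsTwoDesign.card_inter_le_one {P B : Type*} [Fintype P] [DecidableEq P] [Fintype B]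
    {S : IncidenceSystem P B} {v k : ℕ} (hS : S.IsTwoDesign v k 1) {i j : B} (hij : i ≠ j) :
    (S.block i ∩ S.block j).card ≤ 1 := by
  by_contra! h
  obtain ⟨p, hp, q, hq, hpq⟩ := Finset.one_lt_card.mp h
  rw [Finset.mem_inter] at hp hq
  obtain ⟨x, hx⟩ := Finset.card_eq_one.mp (hS.balance p q hpq)
  have hi : i ∈ ({x} : Finset B) := hx ▸ by simp [hp.1, hq.1]
  have hj : j ∈ ({x} : Finset B) := hx ▸ by simp [hp.2, hq.2]
  exact hij ((Finset.mem_singleton.mp hi).trans (Finset.mem_singleton.mp hj).symm)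

end IncidenceSystem

theorem corollary4p7 {P B : Type*} [Fintype P] [DecidableEq P] [Fintype B]
    (m n μ : ℕ) (hn : 2 ≤ n) (hnm : n < m) (hdvd : n ∣ m * (m - 1)) (hμ : 0 < μ)
    (D : IncidenceSystem P B) (v k l l₁ l₂ : ℕ)
    (hD : D.IsTwoDesign v k l) (hqs : D.IsQuasiSymmetric l₁ l₂)
    (hdefect : l₂ - l₁ = μ) (hgraph : IsSteinerGraph n m (D.blockGraph l₂)) :
    ((Odd m ∧ Even n) → IsSquare μ) ∧
    ∃ x y z : ℤ, (x, y, z) ≠ (0, 0, 0) ∧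
      (μ : ℤ) * x ^ 2 + (-1) ^ ((m * n - m).choose 2) * ((m : ℤ) * n - m + 1) * y ^ 2 = z ^ 2 := by
  obtain ⟨b, S₀, hS₀, ⟨e⟩⟩ := hgraph
  obtain ⟨hlt, hint⟩ := hqs
  have hS := hS₀.comp_equiv e.toEquiv
  set S : IncidenceSystem (Fin (m * n - m + 1)) B := ⟨fun i => S₀.block (e.toEquiv i)⟩ with hSdef
  have hadj : ∀ i j, i ≠ j →
      ((S.block i ∩ S.block j).card = 1 ↔ (D.block i ∩ D.block j).card = l₂) := by
    intro i j hij
    have h : e i ≠ e j := fun h => hij (e.injective h)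
    have := e.map_rel_iff (a := i) (b := j)
    simp only [IncidenceSystem.blockGraph, ne_eq, hij, not_false_eq_true, true_and] at this
    exact (and_iff_right h).symm.trans this
  have hmem : ∀ i j, i ≠ j →
      (D.block i ∩ D.block j).card = l₁ ∨ (D.block i ∩ D.block j).card = l₂ := by
    intro i j hij
    have : (D.block i ∩ D.block j).card ∈ D.intersectionNumbers := ⟨i, j, hij, rfl⟩
    simpa [hint] using this
  -- Steiner blocks meet in 0 or 1 points, so the graph isomorphism amounts to an affine relation
  -- between intersection sizes.
  have hrel : ∀ i j, i ≠ j →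
      (D.block i ∩ D.block j).card = l₁ + μ * (S.block i ∩ S.block j).card := by
    intro i j hij
    by_cases h : (S.block i ∩ S.block j).card = 1
    · rw [h, (hadj i j hij).mp h]
      omega
    · have h0 : (S.block i ∩ S.block j).card = 0 := by
        have := hS.card_inter_le_one hij
        omega
      rw [h0, mul_zero, add_zero]
      exact (hmem i j hij).resolve_right fun h2 => h ((hadj i j hij).mpr h2)
  obtain ⟨i, j, hij, hDij⟩ : l₂ ∈ D.intersectionNumbers := by simp [hint]
  obtain ⟨i', j', hij', hDij'⟩ : l₁ ∈ D.intersectionNumbers := by simp [hint]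
  have hSij' : (S.block i' ∩ S.block j').card = 0 := by
    have h1 := hS.card_inter_le_one hij'
    have h2 : (S.block i' ∩ S.block j').card ≠ 1 := fun h => by
      have := (hadj i' j' hij').mp h
      omega
    omega
  have hle : m ≤ m * n := Nat.le_mul_of_pos_right m (by omega)
  obtain ⟨hv, R, hR⟩ := IncidenceSystem.exists_similarity_matrix (m := m) hD hS hn (by omega)
    (by push_cast [Nat.cast_sub hle]; ring) hμ hrel hij ((hadj i j hij).mpr hDij) hij' hSij'
  -- Relabelling the rows by the equal point counts makes `R` square without changing `RᵀR`.
  let f : Fin (m * n - m + 1) ≃ P := (Fintype.equivFinOfCardEq (hD.card_points.trans hv)).symm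
  have hR' : (R.submatrix f id)ᵀ * R.submatrix f id = Rᵀ * R := by
    rw [Matrix.transpose_submatrix, Matrix.submatrix_mul_equiv, Matrix.submatrix_id_id]
  obtain ⟨h1, x, y, z, h0, h2⟩ := isSquare_and_exists_zero (Nat.add_one_pos (m * n - m)) hμ rfl (hR'.trans hR)
  refine ⟨fun ⟨hodd, heven⟩ => h1 ?_, x, y, z, h0, ?_⟩
  · exact (Nat.Even.sub_odd hle (heven.mul_left m) hodd).add_one
  · rw [← h2, Nat.add_sub_cancel]
    push_cast [Nat.cast_sub hle]
    ring
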